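/- Let $X$ be a real Banach space. Write $\ell^2$ for the real Hilbert space of square-summable sequences indexed by $\mathbb N$, $\ell^2_k$ for $\mathbb R^k$ with the Euclidean norm, and $\ell^2(X)$, $\ell^2_k(X)$ for the spaces of square-summable sequences, respectively $k$-tuples, in $X$, with norm $\|(x_i)\|=(\sum_i\|x_i\|^2)^{1/2}$. For $k\in\mathbb N$ put $$e_k(X)=\sup\{\|u\otimes \mathrm{Id}_X\|_{\ell^2(X)\to\ell^2(X)} \;:\; u\colon\ell^2\to\ell^2 \text{ linear},\ \|u\|=1,\ \operatorname{rank}u=k\},$$ $$d_k(X)=\sup\{d(E,\ell^2_{\dim E}) \;:\; E\subset X \text{ a linear subspace},\ \dim E\le k\},$$ where $d(E,F)=\inf\{\|T\|\,\|T^{-1}\| : T\colon E\to F \text{ an isomorphism}\}$ is the Banach-Mazur distance; all suprema are taken in $[0,\infty]$. Then for every $k\in\mathbb N$, $$e_k(X)\le 2\sup_{a\colon\ell^2_k\to\ell^2_k,\ \|a\|\le 1}\|a\otimes \mathrm{Id}_X\|_{\ell^2_k(X)\to\ell^2_k(X)}.$$ In particular, $e_k(X)\le 2\,d_k(X)$ for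 all $k\in\mathbb N$. -/

import Mathlib

open scoped ENNReal TensorProduct

noncomputable section

/-- The space `ℓ²(ι; X)` of square-summable families in `X` with its usual norm. Here `ℓ²` is
`EllTwo ℕ ℝ`, `ℓ²_k` is `EllTwo (Fin k) ℝ`, `ℓ²(X)` is `EllTwo ℕ X` and `ℓ²_k(X)` is
`EllTwo (Fin k) X`. -/
abbrev EllTwo (ι : Type*) (X : Type*) [NormedAddCommGroup X] : Type _ :=
  lp (fun _ : ι => X) 2

/-- The elementary tensor `a ⊗ x` seen as the family `(a i • x)_i` in `ℓ²(ι; X)`. -/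
def elemTensor {ι X : Type*} [NormedAddCommGroup X] [NormedSpace ℝ X]
    (a : EllTwo ι ℝ) (x : X) : EllTwo ι X :=
  ⟨fun i => a i • x, by
    have h := (lp.memℓp a).norm.const_mul ‖x‖
    refine Memℓp.mono' h fun i => ?_
    simp [norm_smul, mul_comm]⟩

/-- The canonical (injective) map `ℓ²(ι) ⊗ X → ℓ²(ι; X)` from the algebraic tensor product, sending
`a ⊗ x` to `(a i • x)_i`. Its range is dense. -/
def tensorToEllTwo (ι X : Type*) [NormedAddCommGroup X] [NormedSpace ℝ X] :
    EllTwo ι ℝ ⊗[ℝ] X →ₗ[ℝ] EllTwo ι X :=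
  TensorProduct.lift <| LinearMap.mk₂ ℝ elemTensor
    (fun a b x => Subtype.ext <| funext fun i => add_smul (a i) (b i) x)
    (fun c a x => Subtype.ext <| funext fun i => mul_smul c (a i) x)
    (fun a x y => Subtype.ext <| funext fun i => smul_add (a i) x y)
    (fun c a x => Subtype.ext <| funext fun i => smul_comm (a i) c x)

/-- The operator norm `‖u ⊗ Id_X‖` on `ℓ²(ι; X)`, with value `∞` if `u ⊗ Id_X` is not bounded.
It is computed on the dense subspace `ℓ²(ι) ⊗ X`, normed as a subspace of `ℓ²(ι; X)`. -/
def tensorIdNorm {ι : Type*} (X : Type*) [NormedAddCommGroup X] [NormedSpace ℝ X]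
    (u : EllTwo ι ℝ →L[ℝ] EllTwo ι ℝ) : ℝ≥0∞ :=
  ⨆ (z : EllTwo ι ℝ ⊗[ℝ] X) (_ : ‖tensorToEllTwo ι X z‖ ≤ 1),
    ‖tensorToEllTwo ι X (LinearMap.rTensor X (u : EllTwo ι ℝ →ₗ[ℝ] EllTwo ι ℝ) z)‖ₑ

/-- The relative Euclidean factorization constant `e_k(X)`: the supremum of `‖u ⊗ Id_X‖` on
`ℓ²(X)` over the linear maps `u : ℓ² → ℓ²` of norm `1` and rank `k`. -/
def relEuclideanConst (k : ℕ) (X : Type*) [NormedAddCommGroup X] [NormedSpace ℝ X] : ℝ≥0∞ :=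
  ⨆ (u : EllTwo ℕ ℝ →L[ℝ] EllTwo ℕ ℝ) (_ : ‖u‖ = 1)
    (_ : LinearMap.rank (u : EllTwo ℕ ℝ →ₗ[ℝ] EllTwo ℕ ℝ) = (k : Cardinal)), tensorIdNorm X u

/-- The Banach-Mazur distance: the infimum of `‖T‖ ‖T⁻¹‖` over all isomorphisms `T : E → F`
(`∞` if there is none). -/
def banachMazurDist (E F : Type*) [NormedAddCommGroup E] [NormedSpace ℝ E]
    [NormedAddCommGroup F] [NormedSpace ℝ F] : ℝ≥0∞ :=
  ⨅ T : E ≃L[ℝ] F, ‖(T : E →L[ℝ] F)‖ₑ * ‖(T.symm : F →L[ℝ] E)‖ₑ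

/-- `d_k(X)`: the supremum of the Banach-Mazur distances `d(E, ℓ²_{dim E})` over the linear
subspaces `E` of `X` of dimension at most `k`. -/
def euclideanDistConst (k : ℕ) (X : Type*) [NormedAddCommGroup X] [NormedSpace ℝ X] : ℝ≥0∞ :=
  ⨆ (E : Submodule ℝ X) (_ : FiniteDimensional ℝ E) (_ : Module.finrank ℝ E ≤ k),
    banachMazurDist E (EllTwo (Fin (Module.finrank ℝ E)) ℝ)

end

/-!
Write `u = ∑ ⟪f n, c i⟫ e n ⊗ e i`, where the rows `f n` and the columns `c i` lie in the
`k`-dimensional range of `u` and satisfy Bessel's inequality. If both families were orthonormal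
bases, the matrix would be a contraction of `ℓ²_k`. A greedy choice of unit vectors, as in the
Dvoretzky–Rogers lemma, shows that for a linear map `V` on a `k`-dimensional Hilbert space and a
Bessel family `a` there is an orthonormal basis `b` with `∑ ‖V (a i)‖ ^ 2 ≤ 2 * ∑ ‖V (b j)‖ ^ 2`.
So replacing `f` by an orthonormal basis costs a factor `√2`, and so does replacing `c`, because
transposition exchanges rows and columns while passing from `X` to its dual.

The bound by `d_k(X)` holds because `a ⊗ Id` has norm at most `‖a‖` on Hilbert spaces, and a
`k`-tuple in `X` spans a subspace of dimension at most `k`.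
-/

open scoped RealInnerProductSpace NNReal Matrix

section WeightedSums

variable {ι Y : Type*} [NormedAddCommGroup Y] [NormedSpace ℝ Y]

theorem norm_sq_mul_apply_normalize {Q : Y → ℝ} (hQ : ∀ (c : ℝ) (y : Y), Q (c • y) = c ^ 2 * Q y)
    (y : Y) : ‖y‖ ^ 2 * Q (NormedSpace.normalize y) = Q y := by
  rw [← hQ, NormedSpace.norm_smul_normalize]

variable [Fintype ι]

theorem sq_sum_apply_le (φ : ι → StrongDual ℝ Y) (y : ι → Y) :
    (∑ i, φ i (y i)) ^ 2 ≤ (∑ i, ‖φ i‖ ^ 2) * ∑ i, ‖y i‖ ^ 2 :=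
  Finset.sum_sq_le_sum_mul_sum_of_sq_le_mul _ (fun i _ => by positivity)
    (fun i _ => by positivity) fun i _ => by
      rw [← mul_pow]
      exact sq_le_sq.mpr (((φ i).le_opNorm (y i)).trans (le_abs_self _))

theorem exists_pos_and_le_of_sum_mul_le {w f g : ι → ℝ} (hw : ∀ i, 0 ≤ w i)
    (hpos : 0 < ∑ i, w i) (h : ∑ i, w i * f i ≤ ∑ i, w i * g i) : ∃ i, 0 < w i ∧ f i ≤ g i := by
  by_contra! hlt
  obtain ⟨j, -, hj⟩ := Finset.exists_lt_of_sum_lt (s := Finset.univ) (f := 0) (g := w) (by simpa)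
  refine h.not_gt (Finset.sum_lt_sum (fun i _ => ?_) ⟨j, Finset.mem_univ j, ?_⟩)
  · rcases (hw i).eq_or_lt with h0 | h0
    · simp [← h0]
    · exact mul_le_mul_of_nonneg_left (hlt i h0).le h0.le
  · exact mul_lt_mul_of_pos_left (hlt j hj) hj

theorem exists_pos_and_sq_sum_mul_le {w f g : ι → ℝ} {S : ℝ} (hw : ∀ i, 0 ≤ w i)
    (hpos : 0 < ∑ i, w i) (h : (∑ i, w i * g i) ^ 2 ≤ S * ∑ i, w i * f i) :
    ∃ i, 0 < w i ∧ (∑ i, w i * g i) ^ 2 ≤ 2 * S * f i + (∑ i, w i * g i - g i) ^ 2 := by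
  set n := ∑ i, w i
  set t := ∑ i, w i * g i with ht
  refine exists_pos_and_le_of_sum_mul_le hw hpos ?_
  have hvar : (n * t - t) ^ 2 ≤ n * ∑ i, w i * (t - g i) ^ 2 := by
    have hres : ∑ i, w i * (t - g i) = n * t - t := by
      simp only [mul_sub, Finset.sum_sub_distrib, ← Finset.sum_mul, ← ht, n]
    rw [← hres]
    exact Finset.sum_sq_le_sum_mul_sum_of_sq_le_mul _ (fun i _ => hw i)
      (fun i _ => mul_nonneg (hw i) (sq_nonneg _)) fun i _ => by linarith
  have hsplit : ∑ i, w i * (2 * S * f i + (t - g i) ^ 2) =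
      2 * (S * ∑ i, w i * f i) + ∑ i, w i * (t - g i) ^ 2 := by
    rw [← mul_assoc, Finset.mul_sum _ _ (2 * S), ← Finset.sum_add_distrib]
    exact Finset.sum_congr rfl fun i _ => by ring
  rw [← Finset.sum_mul, hsplit]
  -- With `n = ∑ i, w i`, the average dominates because `2 / n + (1 - 1 / n) ^ 2 = 1 + 1 / n ^ 2`.
  refine le_of_mul_le_mul_left ?_ hpos
  nlinarith [sq_nonneg t]

end WeightedSums

section Frames

variable {ι H : Type*} [Fintype ι] [NormedAddCommGroup H] [InnerProductSpace ℝ H]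

/-- A finite Parseval frame, encoded by its reconstruction formula `∑ i, p i ⊗ p i = Id`. -/
def IsParsevalFrame (p : ι → H) : Prop :=
  ∀ x, ∑ i, ⟪p i, x⟫ • p i = x

/-- A finite family satisfying Bessel's inequality with constant `1`, i.e. `∑ i, a i ⊗ a i ≤ Id`. -/
def IsBesselFamily (a : ι → H) : Prop :=
  ∀ x, ∑ i, ⟪a i, x⟫ ^ 2 ≤ ‖x‖ ^ 2

namespace IsParsevalFrame

variable {p : ι → H}

theorem sum_norm_sq [FiniteDimensional ℝ H] (hp : IsParsevalFrame p) :
    ∑ i, ‖p i‖ ^ 2 = Module.finrank ℝ H := by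
  have hid : ∑ i, (InnerProductSpace.rankOne ℝ (p i) (p i)).toLinearMap = LinearMap.id :=
    LinearMap.ext fun x => by simpa using hp x
  simpa [map_sum, InnerProductSpace.trace_rankOne] using congrArg (LinearMap.trace ℝ H) hid

theorem orthogonalProjectionOnto (hp : IsParsevalFrame p) (K : Submodule ℝ H)
    [K.HasOrthogonalProjection] : IsParsevalFrame fun i => K.orthogonalProjectionOnto (p i) := by
  intro x
  simpa [map_sum] using congrArg K.orthogonalProjectionOnto (hp x)

end IsParsevalFrame

theorem IsBesselFamily.exists_isParsevalFrame_sumElim [FiniteDimensional ℝ H] {a : ι → H}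
    (ha : IsBesselFamily a) :
    ∃ (m : ℕ) (a' : Fin m → H), IsParsevalFrame (Sum.elim a a') := by
  set D : H →L[ℝ] H := 1 - ∑ i, InnerProductSpace.rankOne ℝ (a i) (a i) with hD
  have hDx : ∀ x, D x = x - ∑ i, ⟪a i, x⟫ • a i := by simp [hD]
  have hpos : D.IsPositive := by
    refine D.isPositive_iff.mpr ⟨fun x y => ?_, fun x => ?_⟩
    · simp [hDx, inner_sub_left, inner_sub_right, sum_inner, inner_sum,
        real_inner_smul_right, real_inner_comm, mul_comm]
    · simpa [hDx, inner_sub_left, sum_inner, real_inner_smul_left, ← sq] using ha x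
  obtain ⟨m, a', ha'⟩ := ContinuousLinearMap.isPositive_iff_eq_sum_rankOne.mp hpos
  refine ⟨m, a', fun x => ?_⟩
  have hDx' : D x = ∑ j, ⟪a' j, x⟫ • a' j := by simp [ha']
  simp [Fintype.sum_sum_type, ← hDx', hDx]

namespace IsParsevalFrame

variable {p : ι → H}

theorem sum_sum_inner_mul_apply (hp : IsParsevalFrame p) (g : ι → Module.Dual ℝ H) :
    ∑ i, ∑ l, ⟪p l, p i⟫ * g l (p i) = ∑ l, g l (p l) := by
  rw [Finset.sum_comm]
  refine Finset.sum_congr rfl fun l _ => ?_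
  calc ∑ i, ⟪p l, p i⟫ * g l (p i) = g l (∑ i, ⟪p i, p l⟫ • p i) := by
        simp [map_sum, real_inner_comm]
    _ = g l (p l) := by rw [hp]

variable {Y : Type*} [NormedAddCommGroup Y] [NormedSpace ℝ Y]

theorem exists_norm_eq_one_sq_sum_apply_le [FiniteDimensional ℝ H] [Nontrivial H]
    (hp : IsParsevalFrame p) (V : H →ₗ[ℝ] Y) (φ : ι → StrongDual ℝ Y) :
    ∃ e : H, ‖e‖ = 1 ∧ (∑ i, φ i (V (p i))) ^ 2 ≤
      2 * (∑ i, ‖φ i‖ ^ 2) * ‖V e‖ ^ 2 +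
        (∑ i, φ i (V (p i)) - ∑ i, ⟪p i, e⟫ * φ i (V e)) ^ 2 := by
  set t := ∑ i, φ i (V (p i))
  set S := ∑ i, ‖φ i‖ ^ 2
  set q : H → ℝ := fun x => ∑ l, ⟪p l, x⟫ * φ l (V x)
  set e : ι → H := fun i => NormedSpace.normalize (p i)
  have hq_sum : ∑ i, ‖p i‖ ^ 2 * q (e i) = t := by
    have hq (c : ℝ) (x : H) : q (c • x) = c ^ 2 * q x := by
      simp only [q, Finset.mul_sum, map_smul, real_inner_smul_right, smul_eq_mul]
      exact Finset.sum_congr rfl fun l _ => by ring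
    simp only [e, norm_sq_mul_apply_normalize hq]
    exact hp.sum_sum_inner_mul_apply fun l => (φ l).toLinearMap ∘ₗ V
  have hV_sum : t ^ 2 ≤ S * ∑ i, ‖p i‖ ^ 2 * ‖V (e i)‖ ^ 2 := by
    have hV (i : ι) : ‖p i‖ ^ 2 * ‖V (e i)‖ ^ 2 = ‖V (p i)‖ ^ 2 :=
      norm_sq_mul_apply_normalize (Q := fun x => ‖V x‖ ^ 2)
        (fun c x => by simp [norm_smul, mul_pow]) (p i)
    simp only [hV]
    exact sq_sum_apply_le φ fun i => V (p i)
  obtain ⟨i, hi, hle⟩ := exists_pos_and_sq_sum_mul_le (w := fun i => ‖p i‖ ^ 2)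
    (fun i => by positivity) (hp.sum_norm_sq ▸ Nat.cast_pos.mpr Module.finrank_pos)
    (hq_sum.symm ▸ hV_sum)
  rw [hq_sum] at hle
  exact ⟨e i, NormedSpace.norm_normalize fun h => by simp [h] at hi, hle⟩

theorem exists_orthonormal_sq_sum_apply_le [FiniteDimensional ℝ H] {m : ℕ}
    (hm : Module.finrank ℝ H = m) (hp : IsParsevalFrame p) (V : H →ₗ[ℝ] Y)
    (φ : ι → StrongDual ℝ Y) :
    ∃ b : Fin m → H, Orthonormal ℝ b ∧
      (∑ i, φ i (V (p i))) ^ 2 ≤ 2 * (∑ i, ‖φ i‖ ^ 2) * ∑ j, ‖V (b j)‖ ^ 2 := by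
  induction m generalizing H with
  | zero =>
    have : Subsingleton H := Module.finrank_zero_iff.mp hm
    exact ⟨Fin.elim0, .of_isEmpty _, by simp [Subsingleton.elim (p _) 0]⟩
  | succ m ih =>
    have : Nontrivial H := Module.nontrivial_of_finrank_eq_succ hm
    obtain ⟨e, he, hle⟩ := hp.exists_norm_eq_one_sq_sum_apply_le V φ
    set K : Submodule ℝ H := (ℝ ∙ e)ᗮ
    have hK : Module.finrank ℝ K = m :=
      have : Fact (Module.finrank ℝ H = m + 1) := ⟨hm⟩
      Submodule.finrank_orthogonal_span_singleton (norm_ne_zero_iff.mp (by simp [he]))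
    obtain ⟨b, hb, hb_le⟩ := ih hK (hp.orthogonalProjectionOnto K) (V.domRestrict K)
    have hproj (x : H) : (K.orthogonalProjectionOnto x : H) = x - ⟪e, x⟫ • e := by
      rw [← Submodule.starProjection_unit_singleton ℝ he]
      exact Submodule.starProjection_orthogonal_val _
    have htrace : ∑ i, φ i (V.domRestrict K (K.orthogonalProjectionOnto (p i))) =
        ∑ i, φ i (V (p i)) - ∑ i, ⟪p i, e⟫ * φ i (V e) := by
      simp [LinearMap.domRestrict_apply, hproj, real_inner_comm e]
    refine ⟨Matrix.vecCons e fun j => (b j : H), ?_, ?_⟩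
    · exact orthonormal_vecCons_iff.mpr ⟨he, fun j =>
        Submodule.mem_orthogonal_singleton_iff_inner_right.mp (b j).2,
        hb.comp_linearIsometry K.subtypeₗᵢ⟩
    · rw [htrace] at hb_le
      simp only [Fin.sum_univ_succ, Matrix.cons_val_zero, Matrix.cons_val_succ, mul_add]
      exact hle.trans (add_le_add_right hb_le _)

end IsParsevalFrame

theorem IsBesselFamily.exists_orthonormalBasis_sum_norm_sq_le [FiniteDimensional ℝ H] {k : ℕ}
    (hk : Module.finrank ℝ H = k) {Y : Type*} [NormedAddCommGroup Y] [NormedSpace ℝ Y]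
    {a : ι → H} (ha : IsBesselFamily a) (V : H →ₗ[ℝ] Y) :
    ∃ b : OrthonormalBasis (Fin k) ℝ H, ∑ i, ‖V (a i)‖ ^ 2 ≤ 2 * ∑ j, ‖V (b j)‖ ^ 2 := by
  obtain ⟨m, a', hp⟩ := ha.exists_isParsevalFrame_sumElim
  choose ψ hψ_norm hψ using fun i => exists_dual_vector'' ℝ (V (a i))
  set φ : ι ⊕ Fin m → StrongDual ℝ Y := Sum.elim (fun i => ‖V (a i)‖ • ψ i) 0
  obtain ⟨b, hb, hle⟩ := hp.exists_orthonormal_sq_sum_apply_le hk V φ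
  set τ := ∑ i, ‖V (a i)‖ ^ 2
  have hpair : ∑ i, φ i (V (Sum.elim a a' i)) = τ := by
    simp [φ, τ, hψ, sq]
  have hφ : ∑ i, ‖φ i‖ ^ 2 ≤ τ := by
    rw [Fintype.sum_sum_type]
    simp only [φ, Sum.elim_inl, Sum.elim_inr, norm_smul, norm_norm, Pi.zero_apply, norm_zero,
      ne_eq, OfNat.ofNat_ne_zero, not_false_eq_true, zero_pow, Finset.sum_const_zero, add_zero]
    refine Finset.sum_le_sum fun i _ => pow_le_pow_left₀ (by positivity) ?_ 2
    exact mul_le_of_le_one_right (norm_nonneg _) (hψ_norm i)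
  have hspan : Submodule.span ℝ (Set.range b) = ⊤ :=
    hb.linearIndependent.span_eq_top_of_card_eq_finrank' (by simp [hk])
  refine ⟨OrthonormalBasis.mk hb hspan.ge, ?_⟩
  rw [OrthonormalBasis.coe_mk]
  rw [hpair] at hle
  have hB : 0 ≤ ∑ j, ‖V (b j)‖ ^ 2 := by positivity
  by_contra! hlt
  nlinarith

end Frames

section TensorBounds

variable {ι κ H X : Type*} [NormedAddCommGroup H] [InnerProductSpace ℝ H]
  [NormedAddCommGroup X] [NormedSpace ℝ X]

/-- The matrix of inner products between two families of vectors: a factorization of an operator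
matrix through the Hilbert space `H`. -/
def crossGram (f : ι → H) (c : κ → H) : Matrix ι κ ℝ :=
  .of fun i j => ⟪f i, c j⟫

theorem transpose_crossGram (f : ι → H) (c : κ → H) : (crossGram f c)ᵀ = crossGram c f := by
  ext i j
  exact real_inner_comm _ _

variable [Fintype ι] [Fintype κ]

/-- The bound `‖A ⊗ Id_X‖ ≤ √C` for the operator `ℓ²(κ; X) → ℓ²(ι; X)` given by a finite scalar
matrix `A`; the constant is squared to avoid square roots. -/
def IsTensorBound (X : Type*) [NormedAddCommGroup X] [NormedSpace ℝ X] (A : Matrix ι κ ℝ)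
    (C : ℝ≥0) : Prop :=
  ∀ x : κ → X, ∑ i, ‖∑ j, A i j • x j‖ ^ 2 ≤ C * ∑ j, ‖x j‖ ^ 2

theorem exists_norm_le_mul_norm_sq_le_apply (φ : StrongDual ℝ X) {θ : ℝ} (hθ : θ < 1) :
    ∃ x, ‖x‖ ≤ ‖φ‖ ∧ θ * ‖φ‖ ^ 2 ≤ φ x := by
  rcases (norm_nonneg φ).eq_or_lt with h0 | h0
  · exact ⟨0, by simp, by simp [← h0]⟩
  obtain ⟨x, hx, hx'⟩ := φ.exists_lt_apply_of_lt_opNorm (show θ * ‖φ‖ < ‖φ‖ by nlinarith)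
  obtain ⟨y, hy, hy'⟩ : ∃ y, ‖y‖ < 1 ∧ θ * ‖φ‖ < φ y := by
    rcases lt_abs.mp (Real.norm_eq_abs (φ x) ▸ hx') with h | h
    · exact ⟨x, hx, h⟩
    · exact ⟨-x, by rwa [norm_neg], by rwa [map_neg]⟩
  refine ⟨‖φ‖ • y, ?_, ?_⟩
  · rw [norm_smul, norm_norm]
    exact mul_le_of_le_one_right h0.le hy.le
  · rw [map_smul, smul_eq_mul]
    nlinarith

theorem sum_norm_sq_le_of_forall_sq_sum_apply_le {η : κ → StrongDual ℝ X} {M : ℝ} (hM : 0 ≤ M)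
    (h : ∀ x : κ → X, (∑ j, η j (x j)) ^ 2 ≤ M * ∑ j, ‖x j‖ ^ 2) : ∑ j, ‖η j‖ ^ 2 ≤ M := by
  set N := ∑ j, ‖η j‖ ^ 2
  have hN : 0 ≤ N := by positivity
  rcases hN.eq_or_lt with hN0 | hN0
  · exact hN0.symm.trans_le hM
  have hθ (θ : ℝ) (hθ0 : 0 ≤ θ) (hθ1 : θ < 1) : θ ^ 2 * N ≤ M := by
    choose x hx hηx using fun j => exists_norm_le_mul_norm_sq_le_apply (η j) hθ1
    refine le_of_mul_le_mul_right ?_ hN0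
    calc θ ^ 2 * N * N = (∑ j, θ * ‖η j‖ ^ 2) ^ 2 := by rw [← Finset.mul_sum]; ring
      _ ≤ (∑ j, η j (x j)) ^ 2 := by gcongr with j; exact hηx j
      _ ≤ M * ∑ j, ‖x j‖ ^ 2 := h x
      _ ≤ M * ∑ j, ‖η j‖ ^ 2 := by gcongr with j; exact hx j
  have hlim : Filter.Tendsto (fun θ : ℝ => θ ^ 2 * N) (nhdsWithin 1 (Set.Iio 1)) (nhds N) :=
    tendsto_nhdsWithin_of_tendsto_nhds (Continuous.tendsto' (by fun_prop) _ _ (by simp))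
  refine le_of_tendsto hlim ?_
  filter_upwards [Ioo_mem_nhdsLT (zero_lt_one' ℝ)] with θ h01
  exact hθ θ h01.1.le h01.2

namespace IsTensorBound

variable {A : Matrix ι κ ℝ} {C : ℝ≥0}

theorem transpose (h : IsTensorBound X A C) : IsTensorBound (StrongDual ℝ X) Aᵀ C := by
  intro ξ
  refine sum_norm_sq_le_of_forall_sq_sum_apply_le (by positivity) fun x => ?_
  calc (∑ j, (∑ i, A i j • ξ i) (x j)) ^ 2 = (∑ i, ξ i (∑ j, A i j • x j)) ^ 2 := by
        congr 1
        simp only [sum_apply, smul_apply, map_sum, map_smul]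
        exact Finset.sum_comm
    _ ≤ (∑ i, ‖ξ i‖ ^ 2) * ∑ i, ‖∑ j, A i j • x j‖ ^ 2 := sq_sum_apply_le ξ _
    _ ≤ (∑ i, ‖ξ i‖ ^ 2) * (C * ∑ j, ‖x j‖ ^ 2) := by gcongr; exact h x
    _ = C * (∑ i, ‖ξ i‖ ^ 2) * ∑ j, ‖x j‖ ^ 2 := by ring

theorem of_linearIsometry {Y : Type*} [NormedAddCommGroup Y] [NormedSpace ℝ Y] (J : X →ₗᵢ[ℝ] Y)
    (h : IsTensorBound Y A C) : IsTensorBound X A C := by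
  intro x
  simpa only [← map_smul, ← map_sum, J.norm_map] using h fun j => J (x j)

theorem of_dual (h : IsTensorBound (StrongDual ℝ X) A C) : IsTensorBound X Aᵀ C :=
  h.transpose.of_linearIsometry (NormedSpace.inclusionInDoubleDualLi ℝ)

end IsTensorBound

variable [FiniteDimensional ℝ H] {k : ℕ} {f : ι → H} {c : κ → H} {C : ℝ≥0}

theorem isTensorBound_crossGram_left (hk : Module.finrank ℝ H = k) (hf : IsBesselFamily f)
    (h : ∀ b : OrthonormalBasis (Fin k) ℝ H, IsTensorBound X (crossGram b c) C) :
    IsTensorBound X (crossGram f c) (2 * C) := by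
  intro x
  set V : H →ₗ[ℝ] X := ∑ j, (innerₛₗ ℝ (c j)).smulRight (x j)
  have hV (r : H) : V r = ∑ j, ⟪r, c j⟫ • x j := by simp [V, real_inner_comm]
  obtain ⟨b, hb⟩ := hf.exists_orthonormalBasis_sum_norm_sq_le hk V
  simp only [hV] at hb
  calc ∑ i, ‖∑ j, ⟪f i, c j⟫ • x j‖ ^ 2 ≤ 2 * ∑ l, ‖∑ j, ⟪b l, c j⟫ • x j‖ ^ 2 := hb
    _ ≤ 2 * (C * ∑ j, ‖x j‖ ^ 2) := by gcongr; exact h b x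
    _ = (2 * C : ℝ≥0) * ∑ j, ‖x j‖ ^ 2 := by push_cast; ring

theorem isTensorBound_crossGram (hk : Module.finrank ℝ H = k) (hf : IsBesselFamily f)
    (hc : IsBesselFamily c)
    (h : ∀ b b' : OrthonormalBasis (Fin k) ℝ H, IsTensorBound X (crossGram b b') C) :
    IsTensorBound X (crossGram f c) (2 * (2 * C)) := by
  refine isTensorBound_crossGram_left hk hf fun b => ?_
  have hdual : IsTensorBound (StrongDual ℝ X) (crossGram c b) (2 * C) :=
    isTensorBound_crossGram_left hk hc fun b' => by
      simpa only [transpose_crossGram] using (h b b').transpose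
  simpa only [transpose_crossGram] using hdual.of_dual

end TensorBounds

section TensorNorm

variable {ι X : Type*} [NormedAddCommGroup X]

namespace EllTwo

theorem hasSum_norm_sq (x : EllTwo ι X) : HasSum (fun i => ‖x i‖ ^ 2) (‖x‖ ^ 2) := by
  simpa using lp.hasSum_norm (p := 2) (by simp) x

theorem sum_norm_sq_le (x : EllTwo ι X) (s : Finset ι) : ∑ i ∈ s, ‖x i‖ ^ 2 ≤ ‖x‖ ^ 2 :=
  sum_le_hasSum s (fun _ _ => by positivity) x.hasSum_norm_sq

theorem norm_sq_eq_sum [Fintype ι] (x : EllTwo ι X) : ‖x‖ ^ 2 = ∑ i, ‖x i‖ ^ 2 :=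
  x.hasSum_norm_sq.unique (hasSum_fintype _)

theorem norm_le_of_forall_sum_le {x : EllTwo ι X} {C : ℝ} (hC : 0 ≤ C)
    (h : ∀ s : Finset ι, ∑ i ∈ s, ‖x i‖ ^ 2 ≤ C ^ 2) : ‖x‖ ≤ C :=
  (sq_le_sq₀ (norm_nonneg _) hC).mp (hasSum_le_of_sum_le x.hasSum_norm_sq h)

/-- A family indexed by a finite type as an element of `ℓ²(ι; X)`. -/
def ofFun [Finite ι] (x : ι → X) : EllTwo ι X :=
  ⟨x, Memℓp.all x⟩

@[simp]
theorem ofFun_apply [Finite ι] (x : ι → X) (i : ι) : ofFun x i = x i :=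
  rfl

/-- The standard Hilbert basis of `ℓ²(ι)`. -/
noncomputable def stdBasis (ι : Type*) : HilbertBasis ι ℝ (EllTwo ι ℝ) :=
  .ofRepr (.refl ℝ _)

theorem inner_stdBasis_left (v : EllTwo ι ℝ) (i : ι) : ⟪stdBasis ι i, v⟫ = v i :=
  ((stdBasis ι).repr_apply_apply v i).symm

theorem stdBasis_apply [DecidableEq ι] (i j : ι) :
    stdBasis ι i j = if j = i then (1 : ℝ) else 0 := by
  rw [← inner_stdBasis_left, orthonormal_iff_ite.mp (stdBasis ι).orthonormal]

end EllTwo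

/-- The matrix of an operator on `ℓ²(ι)` with respect to the standard basis. -/
noncomputable def opMatrix (u : EllTwo ι ℝ →L[ℝ] EllTwo ι ℝ) : Matrix ι ι ℝ :=
  .of fun n i => u (EllTwo.stdBasis ι i) n

theorem hasSum_opMatrix_mul (u : EllTwo ι ℝ →L[ℝ] EllTwo ι ℝ) (v : EllTwo ι ℝ) (n : ι) :
    HasSum (fun i => opMatrix u n i * v i) (u v n) := by
  have h := (((EllTwo.stdBasis ι).hasSum_repr v).mapL u).mapL (lp.evalCLM ℝ (fun _ : ι => ℝ) 2 n)
  simpa [lp.evalCLM, opMatrix, EllTwo.stdBasis, mul_comm] using h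

variable [NormedSpace ℝ X]

theorem hasSum_tensorToEllTwo_rTensor (u : EllTwo ι ℝ →L[ℝ] EllTwo ι ℝ)
    (z : EllTwo ι ℝ ⊗[ℝ] X) (n : ι) :
    HasSum (fun i => opMatrix u n i • tensorToEllTwo ι X z i)
      (tensorToEllTwo ι X (LinearMap.rTensor X (u : EllTwo ι ℝ →ₗ[ℝ] EllTwo ι ℝ) z) n) := by
  induction z with
  | zero => simp
  | tmul v x =>
    convert (hasSum_opMatrix_mul u v n).smul_const x using 2 with i
    · exact smul_smul _ _ _
    · rfl
  | add z w hz hw =>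
    simp only [map_add, lp.coeFn_add, Pi.add_apply, smul_add]
    exact hz.add hw

theorem tensorToEllTwo_surjective [Finite ι] : Function.Surjective (tensorToEllTwo ι X) := by
  classical
  have := Fintype.ofFinite ι
  intro x
  refine ⟨∑ i, EllTwo.stdBasis ι i ⊗ₜ x i, ?_⟩
  ext j
  rw [map_sum, lp.coeFn_sum, Finset.sum_apply]
  simp [tensorToEllTwo, elemTensor, EllTwo.stdBasis_apply]

theorem tensorIdNorm_le_iff {u : EllTwo ι ℝ →L[ℝ] EllTwo ι ℝ} {d : ℝ≥0} :
    tensorIdNorm X u ≤ d ↔ ∀ z : EllTwo ι ℝ ⊗[ℝ] X,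
      ‖tensorToEllTwo ι X (LinearMap.rTensor X (u : EllTwo ι ℝ →ₗ[ℝ] EllTwo ι ℝ) z)‖ ≤
        d * ‖tensorToEllTwo ι X z‖ := by
  set U := LinearMap.rTensor X (u : EllTwo ι ℝ →ₗ[ℝ] EllTwo ι ℝ)
  have hle : tensorIdNorm X u ≤ d ↔ ∀ z : EllTwo ι ℝ ⊗[ℝ] X, ‖tensorToEllTwo ι X z‖ ≤ 1 →
      ‖tensorToEllTwo ι X (U z)‖ ≤ d := by
    simp only [tensorIdNorm, iSup_le_iff, enorm_le_coe, ← NNReal.coe_le_coe, coe_nnnorm, U]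
  rw [hle]
  refine ⟨fun h z => ?_, fun h z hz => (h z).trans (mul_le_of_le_one_right d.2 hz)⟩
  rcases (norm_nonneg (tensorToEllTwo ι X z)).eq_or_lt with h0 | h0
  · have hUz : tensorToEllTwo ι X (U z) = 0 := by
      ext n
      refine (hasSum_tensorToEllTwo_rTensor u z n).unique ?_
      simp [norm_eq_zero.mp h0.symm]
    simp [hUz, ← h0]
  · have hz := h (‖tensorToEllTwo ι X z‖⁻¹ • z) (by
      rw [map_smul, norm_smul, norm_inv, norm_norm, inv_mul_cancel₀ h0.ne'])
    rwa [map_smul, map_smul, norm_smul, norm_inv, norm_norm, inv_mul_le_iff₀' h0] at hz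

theorem tensorIdNorm_le_iff_isTensorBound [Fintype ι] {a : EllTwo ι ℝ →L[ℝ] EllTwo ι ℝ}
    {d : ℝ≥0} : tensorIdNorm X a ≤ d ↔ IsTensorBound X (opMatrix a) (d ^ 2) := by
  have hsq (z : EllTwo ι ℝ ⊗[ℝ] X) :
      ‖tensorToEllTwo ι X (LinearMap.rTensor X (a : EllTwo ι ℝ →ₗ[ℝ] EllTwo ι ℝ) z)‖ ≤
          d * ‖tensorToEllTwo ι X z‖ ↔
        ∑ n, ‖∑ i, opMatrix a n i • tensorToEllTwo ι X z i‖ ^ 2 ≤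
          (d ^ 2 : ℝ≥0) * ∑ i, ‖tensorToEllTwo ι X z i‖ ^ 2 := by
    rw [← sq_le_sq₀ (norm_nonneg _) (by positivity), mul_pow, EllTwo.norm_sq_eq_sum,
      EllTwo.norm_sq_eq_sum, NNReal.coe_pow]
    simp only [fun n => (hasSum_tensorToEllTwo_rTensor a z n).unique (hasSum_fintype _)]
  simp only [tensorIdNorm_le_iff, hsq]
  refine ⟨fun h x => ?_, fun h z => h _⟩
  obtain ⟨z, hz⟩ := tensorToEllTwo_surjective (EllTwo.ofFun x)
  simpa only [hz, EllTwo.ofFun_apply] using h z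

theorem tensorIdNorm_le_of_forall_submatrix {u : EllTwo ι ℝ →L[ℝ] EllTwo ι ℝ} {d : ℝ≥0}
    (h : ∀ s t : Finset ι,
      IsTensorBound X ((opMatrix u).submatrix ((↑) : s → ι) ((↑) : t → ι)) (d ^ 2)) :
    tensorIdNorm X u ≤ d := by
  refine tensorIdNorm_le_iff.mpr fun z => ?_
  refine EllTwo.norm_le_of_forall_sum_le (by positivity) fun s => ?_
  have hlim := tendsto_finsetSum s fun n _ => ((hasSum_tensorToEllTwo_rTensor u z n).norm).pow 2
  refine le_of_tendsto hlim (.of_forall fun t => ?_)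
  set x := tensorToEllTwo ι X z
  calc ∑ n ∈ s, ‖∑ i ∈ t, opMatrix u n i • x i‖ ^ 2
      = ∑ n : s, ‖∑ i : t, opMatrix u n i • x i‖ ^ 2 := by
        simp only [fun n => Finset.sum_coe_sort t fun i => opMatrix u n i • x i]
        exact (Finset.sum_coe_sort s fun n => ‖∑ i ∈ t, opMatrix u n i • x i‖ ^ 2).symm
    _ ≤ (d ^ 2 : ℝ≥0) * ∑ i : t, ‖x i‖ ^ 2 := h s t fun i => x i
    _ ≤ (d ^ 2 : ℝ≥0) * ‖x‖ ^ 2 := by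
        gcongr
        exact (Finset.sum_coe_sort t fun i => ‖x i‖ ^ 2).trans_le (x.sum_norm_sq_le t)
    _ = (d * ‖x‖) ^ 2 := by rw [NNReal.coe_pow, mul_pow]

theorem isBesselFamily_map_of_orthonormal {E H : Type*} [NormedAddCommGroup E]
    [InnerProductSpace ℝ E] [CompleteSpace E] [NormedAddCommGroup H] [InnerProductSpace ℝ H]
    [CompleteSpace H] {L : E →L[ℝ] H} (hL : ‖L‖ ≤ 1) {κ : Type*} [Fintype κ] {b : κ → E}
    (hb : Orthonormal ℝ b) :
    IsBesselFamily fun i => L (b i) := by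
  intro x
  calc ∑ i, ⟪L (b i), x⟫ ^ 2 = ∑ i, ‖⟪b i, L.adjoint x⟫‖ ^ 2 := by
        simp [ContinuousLinearMap.adjoint_inner_right]
    _ ≤ ‖L.adjoint x‖ ^ 2 := hb.sum_inner_products_le _
    _ ≤ ‖x‖ ^ 2 := by
        gcongr
        exact L.adjoint.le_of_opNorm_le_of_le (by simpa using hL) le_rfl |>.trans_eq (one_mul _)

theorem exists_opMatrix_eq_crossGram {H : Type*} [NormedAddCommGroup H] [InnerProductSpace ℝ H]
    (b b' : HilbertBasis ι ℝ H) :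
    ∃ a : EllTwo ι ℝ →L[ℝ] EllTwo ι ℝ, ‖a‖ ≤ 1 ∧ opMatrix a = crossGram b b' := by
  let a := b'.repr.symm.trans b.repr
  refine ⟨a.toContinuousLinearEquiv, a.toLinearIsometry.norm_toContinuousLinearMap_le, ?_⟩
  ext n i
  exact b.repr_apply_apply (b' i) n

theorem tensorIdNorm_le_of_rank_eq {k : ℕ} {d : ℝ≥0}
    (hX : ∀ a : EllTwo (Fin k) ℝ →L[ℝ] EllTwo (Fin k) ℝ, ‖a‖ ≤ 1 → tensorIdNorm X a ≤ d)
    {u : EllTwo ι ℝ →L[ℝ] EllTwo ι ℝ} (hu : ‖u‖ ≤ 1)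
    (hrank : LinearMap.rank (u : EllTwo ι ℝ →ₗ[ℝ] EllTwo ι ℝ) = (k : Cardinal)) :
    tensorIdNorm X u ≤ (2 * d : ℝ≥0) := by
  set R := LinearMap.range (u : EllTwo ι ℝ →ₗ[ℝ] EllTwo ι ℝ)
  have : FiniteDimensional ℝ R := Module.finite_of_rank_eq_nat hrank
  have hR : Module.finrank ℝ R = k := Module.finrank_eq_of_rank_eq hrank
  set P : EllTwo ι ℝ →L[ℝ] R := R.orthogonalProjectionOnto
  have hP : ‖P‖ ≤ 1 := R.orthogonalProjectionOnto_norm_le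
  have hPu : ‖P ∘L u‖ ≤ 1 :=
    (ContinuousLinearMap.opNorm_comp_le P u).trans (mul_le_one₀ hP (norm_nonneg u) hu)
  have hbases (b b' : OrthonormalBasis (Fin k) ℝ R) :
      IsTensorBound X (crossGram b b') (d ^ 2) := by
    obtain ⟨a, ha, hab⟩ := exists_opMatrix_eq_crossGram b.toHilbertBasis b'.toHilbertBasis
    rw [b.coe_toHilbertBasis, b'.coe_toHilbertBasis] at hab
    exact hab ▸ tensorIdNorm_le_iff_isTensorBound.mp (hX a ha)
  refine tensorIdNorm_le_of_forall_submatrix fun s t => ?_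
  have he (s : Finset ι) : Orthonormal ℝ fun i : s => EllTwo.stdBasis ι i :=
    (EllTwo.stdBasis ι).orthonormal.comp _ Subtype.val_injective
  have hfactor : (opMatrix u).submatrix ((↑) : s → ι) ((↑) : t → ι) =
      crossGram (fun n : s => P (EllTwo.stdBasis ι n))
        (fun i : t => (P ∘L u) (EllTwo.stdBasis ι i)) := by
    ext n i
    set e := EllTwo.stdBasis ι
    set r : R := ⟨u (e i), LinearMap.mem_range_self _ _⟩
    calc u (e i) n = ⟪e n, (r : EllTwo ι ℝ)⟫ := (EllTwo.inner_stdBasis_left _ _).symm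
      _ = ⟪P (e n), r⟫ := (R.inner_orthogonalProjectionOnto_eq_of_mem_right r (e n)).symm
      _ = ⟪P (e n), P r⟫ := by rw [R.orthogonalProjectionOnto_mem_subspace_eq_self]
  have hsq : (2 * d) ^ 2 = 2 * (2 * d ^ 2) := by ring
  rw [hfactor, hsq]
  exact isTensorBound_crossGram hR (isBesselFamily_map_of_orthonormal hP (he s))
    (isBesselFamily_map_of_orthonormal hPu (he t)) hbases

theorem relEuclideanConst_le (k : ℕ) :
    relEuclideanConst k X ≤
      2 * ⨆ (a : EllTwo (Fin k) ℝ →L[ℝ] EllTwo (Fin k) ℝ) (_ : ‖a‖ ≤ 1), tensorIdNorm X a := by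
  generalize hD : (⨆ (a : EllTwo (Fin k) ℝ →L[ℝ] EllTwo (Fin k) ℝ) (_ : ‖a‖ ≤ 1),
    tensorIdNorm X a) = D
  rcases eq_or_ne D ⊤ with rfl | h
  · simp
  lift D to ℝ≥0 using h
  have hX (a : EllTwo (Fin k) ℝ →L[ℝ] EllTwo (Fin k) ℝ) (ha : ‖a‖ ≤ 1) : tensorIdNorm X a ≤ D :=
    hD ▸ le_iSup₂_of_le a ha le_rfl
  exact iSup_le fun u => iSup₂_le fun hu hrank => tensorIdNorm_le_of_rank_eq hX hu.le hrank

theorem isTensorBound_opMatrix_ellTwo [Fintype ι] {κ : Type*} {a : EllTwo ι ℝ →L[ℝ] EllTwo ι ℝ}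
    (ha : ‖a‖ ≤ 1) : IsTensorBound (EllTwo κ ℝ) (opMatrix a) 1 := by
  intro x
  rw [NNReal.coe_one, one_mul]
  refine hasSum_le (fun l => ?_) (hasSum_sum fun n _ => EllTwo.hasSum_norm_sq _)
    (hasSum_sum fun i _ => EllTwo.hasSum_norm_sq _)
  set v : EllTwo ι ℝ := EllTwo.ofFun fun i => x i l
  have hav (n : ι) : (∑ i, opMatrix a n i • x i : EllTwo κ ℝ) l = a v n := by
    rw [(hasSum_opMatrix_mul a v n).unique (hasSum_fintype _), lp.coeFn_sum, Finset.sum_apply]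
    rfl
  calc ∑ n, ‖(∑ i, opMatrix a n i • x i : EllTwo κ ℝ) l‖ ^ 2 = ‖a v‖ ^ 2 := by
        simp only [hav, EllTwo.norm_sq_eq_sum]
    _ ≤ ‖v‖ ^ 2 := by
        gcongr
        exact (a.le_of_opNorm_le ha v).trans_eq (one_mul _)
    _ = ∑ i, ‖x i l‖ ^ 2 := v.norm_sq_eq_sum

theorem IsTensorBound.of_continuousLinearEquiv {κ F : Type*} [Fintype ι] [Fintype κ]
    [NormedAddCommGroup F] [NormedSpace ℝ F] {A : Matrix ι κ ℝ} {C : ℝ≥0}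
    (h : IsTensorBound F A C) (T : X ≃L[ℝ] F) :
    IsTensorBound X A ((‖(T : X →L[ℝ] F)‖₊ * ‖(T.symm : F →L[ℝ] X)‖₊) ^ 2 * C) := by
  intro x
  have hT (x : X) : ‖T x‖ ≤ ‖(T : X →L[ℝ] F)‖ * ‖x‖ := (T : X →L[ℝ] F).le_opNorm x
  have hTsymm (y : X) : ‖y‖ ≤ ‖(T.symm : F →L[ℝ] X)‖ * ‖T y‖ := by
    simpa using (T.symm : F →L[ℝ] X).le_opNorm (T y)
  set M := ‖(T : X →L[ℝ] F)‖
  set M' := ‖(T.symm : F →L[ℝ] X)‖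
  calc ∑ i, ‖∑ j, A i j • x j‖ ^ 2 ≤ ∑ i, (M' * ‖∑ j, A i j • T (x j)‖) ^ 2 := by
        gcongr with i
        simpa only [map_sum, map_smul] using hTsymm (∑ j, A i j • x j)
    _ = M' ^ 2 * ∑ i, ‖∑ j, A i j • T (x j)‖ ^ 2 := by simp only [mul_pow, Finset.mul_sum]
    _ ≤ M' ^ 2 * (C * ∑ j, ‖T (x j)‖ ^ 2) := by gcongr; exact h fun j => T (x j)
    _ ≤ M' ^ 2 * (C * ∑ j, (M * ‖x j‖) ^ 2) := by gcongr with j; exact hT (x j)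
    _ = ((‖(T : X →L[ℝ] F)‖₊ * ‖(T.symm : F →L[ℝ] X)‖₊) ^ 2 * C : ℝ≥0) * ∑ j, ‖x j‖ ^ 2 := by
        simp only [mul_pow, ← Finset.mul_sum]
        push_cast
        ring

theorem tensorIdNorm_le_banachMazurDist [Finite ι] (κ : Type*)
    {a : EllTwo ι ℝ →L[ℝ] EllTwo ι ℝ} (ha : ‖a‖ ≤ 1) :
    tensorIdNorm X a ≤ banachMazurDist X (EllTwo κ ℝ) := by
  have := Fintype.ofFinite ι
  refine le_iInf fun T => tensorIdNorm_le_iff_isTensorBound.mpr ?_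
  simpa only [mul_one] using (isTensorBound_opMatrix_ellTwo ha).of_continuousLinearEquiv T

theorem tensorIdNorm_le_of_forall_submodule [Fintype ι] {a : EllTwo ι ℝ →L[ℝ] EllTwo ι ℝ}
    {d : ℝ≥0∞} (h : ∀ E : Submodule ℝ X, FiniteDimensional ℝ E →
      Module.finrank ℝ E ≤ Fintype.card ι → tensorIdNorm E a ≤ d) :
    tensorIdNorm X a ≤ d := by
  rcases eq_or_ne d ⊤ with rfl | hd
  · exact le_top
  lift d to ℝ≥0 using hd
  refine tensorIdNorm_le_iff_isTensorBound.mpr fun x => ?_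
  set E := Submodule.span ℝ (Set.range x)
  have hE := tensorIdNorm_le_iff_isTensorBound.mp
    (h E (.span_of_finite ℝ (Set.finite_range x)) (finrank_range_le_card x))
  simpa only [Submodule.coe_norm, Submodule.coe_sum, Submodule.coe_smul] using
    hE fun i => ⟨x i, Submodule.subset_span ⟨i, rfl⟩⟩

theorem tensorIdNorm_le_euclideanDistConst {k : ℕ}
    {a : EllTwo (Fin k) ℝ →L[ℝ] EllTwo (Fin k) ℝ} (ha : ‖a‖ ≤ 1) :
    tensorIdNorm X a ≤ euclideanDistConst k X :=
  tensorIdNorm_le_of_forall_submodule fun E hE hk =>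
    (tensorIdNorm_le_banachMazurDist _ ha).trans <|
      le_iSup_of_le E <| le_iSup₂_of_le hE (hk.trans_eq (Fintype.card_fin k)) le_rfl

end TensorNorm

theorem theorem5p2_general (X : Type*) [NormedAddCommGroup X] [NormedSpace ℝ X] (k : ℕ) :
    relEuclideanConst k X ≤
        2 * (⨆ (a : EllTwo (Fin k) ℝ →L[ℝ] EllTwo (Fin k) ℝ) (_ : ‖a‖ ≤ 1), tensorIdNorm X a) ∧
      relEuclideanConst k X ≤ 2 * euclideanDistConst k X := by
  refine ⟨relEuclideanConst_le k, (relEuclideanConst_le k).trans ?_⟩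
  gcongr
  exact iSup₂_le fun a ha => tensorIdNorm_le_euclideanDistConst ha

theorem theorem5p2 (X : Type*) [NormedAddCommGroup X] [NormedSpace ℝ X] [CompleteSpace X]
    (k : ℕ) :
    relEuclideanConst k X ≤
        2 * (⨆ (a : EllTwo (Fin k) ℝ →L[ℝ] EllTwo (Fin k) ℝ) (_ : ‖a‖ ≤ 1), tensorIdNorm X a) ∧
      relEuclideanConst k X ≤ 2 * euclideanDistConst k X :=
  theorem5p2_general X k
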